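/- All graphs are finite and simple, and $d_\Gamma$ denotes the shortest-path distance in a connected graph $\Gamma$. A set $S\subseteq V(\Gamma)$ is a $k$-metric generator for $\Gamma$ if for any two different vertices $x,y$ of $\Gamma$ there are at least $k$ vertices $w\in S$ with $d_\Gamma(x,w)\neq d_\Gamma(y,w)$; $\dim_k(\Gamma)$ is the minimum cardinality of a $k$-metric generator for $\Gamma$, and $\dim(\Gamma)=\dim_1(\Gamma)$ is the usual metric dimension. For a graph $G$ with vertices $v_1,\dots,v_n$ and a family $\mathcal H=\{H_1,\dots,H_n\}$ of graphs, the corona product $G\odot\mathcal H$ is obtained from the disjoint union of $G,H_1,\dots,H_n$ by joining $v_i$ by an edge to every vertex of $H_i$, for each $i$. Let $\overline{\mathcal H}=\{\overline{H_1},\dots,\overline{H_n}\}$ be the family of complements, and $K_1\diamond\mathcal H=\{K_1+H_1,\dots,K_1+H_n\}$, where $K_1+H_i$ is $H_i$ together with one new vertex adjacent to all vertices of $H_i$. Let $G$ be a connected graph of order $n\ge 2$ and let $\mathcal H=\{H_1,\dots,H_n\}$ be a family of paths, where $H_i$ has order (number of vertices) $n_i$. (i) If $n_i\ge 7$ for all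 $i\in\{1,\dots,n\}$, then $$\dim(G\odot\mathcal H)=\dim(G\odot\overline{\mathcal H})=\dim(G\odot(K_1\diamond\mathcal H))=\sum_{i=1}^n\left\lfloor\frac{2n_i+2}{5}\right\rfloor.$$ (ii) If $n_i\ge 6$ for all $i\in\{1,\dots,n\}$, then $$\dim_2(G\odot\mathcal H)=\dim_2(G\odot\overline{\mathcal H})=\dim_2(G\odot(K_1\diamond\mathcal H))=\sum_{i=1}^n\left\lceil\frac{n_i+1}{2}\right\rceil.$$ (iii) If $n_i\ge 6$ for all $i\in\{1,\dots,n\}$, then $$\dim_3(G\odot\mathcal H)=\dim_3(G\odot\overline{\mathcal H})=\dim_3(G\odot(K_1\diamond\mathcal H))=\sum_{i=1}^n\left(n_i-\left\lfloor\frac{n_i-4}{5}\right\rfloor\right).$$ -/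

import Mathlib

namespace KMetric

universe u v w

section generators

variable {V : Type u}

/-- The set of vertices distinguishing `x` and `y`, i.e. having different distances to `x` and
`y` (intended for connected graphs, where `SimpleGraph.dist` is the length of a shortest path). -/
def distinctive (G : SimpleGraph V) (x y : V) : Set V :=
  {z | G.dist x z ≠ G.dist y z}

/-- `S` is a metric generator (resolving set): any two different vertices are distinguished by
some element of `S`. -/
def IsMetricGenerator (G : SimpleGraph V) (S : Set V) : Prop :=
  ∀ x y : V, x ≠ y → ∃ s ∈ S, G.dist x s ≠ G.dist y s

/-- The metric dimension `dim(G)`: the smallest cardinality of a metric generator. -/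
noncomputable def metricDim (G : SimpleGraph V) : ℕ∞ :=
  ⨅ S ∈ {S : Set V | IsMetricGenerator G S}, S.encard

/-- `S` is a `k`-metric generator: any two different vertices are distinguished by at least `k`
elements of `S`. -/
def IsKMetricGenerator (G : SimpleGraph V) (k : ℕ) (S : Set V) : Prop :=
  ∀ x y : V, x ≠ y → (k : ℕ∞) ≤ (S ∩ distinctive G x y).encard

/-- The `k`-metric dimension `dim_k(G)`: the smallest cardinality of a `k`-metric generator.
It is `⊤` when there is no `k`-metric generator, so an equation `kMetricDim G k = (m : ℕ)` includes
the existence of a `k`-metric basis. -/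
noncomputable def kMetricDim (G : SimpleGraph V) (k : ℕ) : ℕ∞ :=
  ⨅ S ∈ {S : Set V | IsKMetricGenerator G k S}, S.encard

end generators

section products

/-- The join `G + H`: the disjoint union of `G` and `H` with all edges between them added. -/
def join {V : Type u} {W : Type v} (G : SimpleGraph V) (H : SimpleGraph W) :
    SimpleGraph (V ⊕ W) :=
  (G ⊕g H) ⊔ completeBipartiteGraph V W

/-- The corona product `G ⊙ 𝓗`: the disjoint union of `G` and of the graphs `H i`, one for each
vertex `i` of `G`, where `i` is joined to every vertex of `H i`. -/
def corona {V : Type u} {W : V → Type v} (G : SimpleGraph V) (H : ∀ i, SimpleGraph (W i)) :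
    SimpleGraph (V ⊕ (Σ i, W i)) where
  Adj
    | Sum.inl i, Sum.inl j => G.Adj i j
    | Sum.inl i, Sum.inr q => i = q.1
    | Sum.inr p, Sum.inl j => j = p.1
    | Sum.inr p, Sum.inr q => ∃ (i : V) (a b : W i), p = ⟨i, a⟩ ∧ q = ⟨i, b⟩ ∧ (H i).Adj a b
  symm.symm
    | Sum.inl _, Sum.inl _ => fun h => G.adj_symm h
    | Sum.inl _, Sum.inr _ => fun h => h
    | Sum.inr _, Sum.inl _ => fun h => h
    | Sum.inr _, Sum.inr _ => fun ⟨i, a, b, hp, hq, h⟩ => ⟨i, b, a, hq, hp, (H i).adj_symm h⟩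
  loopless.irrefl
    | Sum.inl _ => fun h => G.irrefl h
    | Sum.inr _ => by
        rintro ⟨i, a, b, rfl, hq, h⟩
        obtain rfl : a = b := by simpa using hq
        exact (H i).irrefl h

/-- The family of the complements of the graphs in `H`. -/
def complFamily {V : Type u} {W : V → Type v} (H : ∀ i, SimpleGraph (W i)) :
    ∀ i, SimpleGraph (W i) :=
  fun i => (H i)ᶜ

/-- The family `K₁ ⋄ 𝓗` of the graphs `K₁ + H i`. -/
def coneFamily {V : Type u} {W : V → Type v} (H : ∀ i, SimpleGraph (W i)) :
    ∀ i, SimpleGraph (Unit ⊕ W i) :=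
  fun i => join (⊤ : SimpleGraph Unit) (H i)

end products

end KMetric

namespace KMetric

universe u v w

/-! The proof reduces the distance problem to one on 0-1 sequences. Inside a copy of `H i` distances
in the corona are 0, 1 or 2 according to equality and adjacency, and vertices outside that copy see
all of it at the same distance. Hence a `k`-metric generator traces a `k`-adjacency generator on
every copy. Conversely, a union of such generators with at least `k` elements each works, since any
pair not lying in one copy is distinguished by every vertex of some copy. So `dim_k` is the sum of
the `k`-adjacency dimensions of the `H i` (`kMetricDim_corona`).

Adjacency dimension is unchanged by complements, and by adding a cone vertex when degrees are at
most 2 and the dimension is at least `k + 2`. Only paths remain. There the generator condition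
becomes the local inequalities of `PathSeparating`, and the minimum weights follow from counting in
blocks of four or five, matched by nearly periodic patterns. -/

/-- If `f` changes by at most one along edges, vanishes exactly at `w` and can be decreased along
an edge everywhere else, then `f` is the distance to `w`. -/
theorem dist_eq_of_potential {V : Type u} {G : SimpleGraph V} (f : V → ℕ) (w : V)
    (hlip : ∀ x y, G.Adj x y → f x ≤ f y + 1) (hw : f w = 0) (hz : ∀ x, f x = 0 → x = w)
    (hdec : ∀ x, f x ≠ 0 → ∃ y, G.Adj x y ∧ f y + 1 = f x) (x : V) : G.dist x w = f x := by
  have lower : ∀ {x y : V} (p : G.Walk x y), f x ≤ f y + p.length := by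
    intro x y p
    induction p with
    | nil => simp
    | cons h p ih =>
      have := hlip _ _ h
      rw [SimpleGraph.Walk.length_cons]
      omega
  have upper : ∀ n x, f x = n → ∃ p : G.Walk x w, p.length = n := by
    intro n
    induction n with
    | zero =>
      intro x hx
      obtain rfl := hz x hx
      exact ⟨.nil, rfl⟩
    | succ n ih =>
      intro x hx
      obtain ⟨y, hxy, hy⟩ := hdec x (by omega)
      obtain ⟨p, hp⟩ := ih y (by omega)
      exact ⟨.cons hxy p, by simp [hp]⟩
  obtain ⟨p, hp⟩ := upper _ x rfl
  refine le_antisymm (hp ▸ G.dist_le p) ?_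
  obtain ⟨q, hq⟩ := p.reachable.exists_walk_length_eq_dist
  have := lower q
  omega

theorem exists_adj_dist_add_one {V : Type u} {G : SimpleGraph V} (hG : G.Connected) {x y : V}
    (h : x ≠ y) : ∃ z, G.Adj x z ∧ G.dist z y + 1 = G.dist x y := by
  obtain ⟨p, hp⟩ := hG.exists_walk_length_eq_dist x y
  cases p with
  | nil => exact absurd rfl h
  | cons hxz q =>
    rename_i z
    refine ⟨z, hxz, ?_⟩
    have h1 := G.dist_le q
    have h2 := hG.dist_triangle (u := x) (v := z) (w := y)
    rw [SimpleGraph.dist_eq_one_iff_adj.2 hxz] at h2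
    rw [SimpleGraph.Walk.length_cons] at hp
    omega

/-! ### Distances in corona products. -/

section Corona

variable {V : Type u} {W : V → Type v} {G : SimpleGraph V} {H : ∀ i, SimpleGraph (W i)}

theorem corona_adj_inr_same {i : V} {a b : W i} :
    (corona G H).Adj (Sum.inr ⟨i, a⟩) (Sum.inr ⟨i, b⟩) ↔ (H i).Adj a b := by
  constructor
  · rintro ⟨j, a', b', h1, h2, h⟩
    obtain ⟨rfl, h1⟩ := Sigma.mk.inj h1
    obtain ⟨-, h2⟩ := Sigma.mk.inj h2
    obtain rfl := eq_of_heq h1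
    obtain rfl := eq_of_heq h2
    exact h
  · exact fun h => ⟨i, a, b, rfl, rfl, h⟩

open Classical in
/-- The distance in a corona product to the vertex `b` of the copy of `H j`. -/
noncomputable def coronaDist (G : SimpleGraph V) (H : ∀ i, SimpleGraph (W i)) (j : V) (b : W j) :
    V ⊕ (Σ i, W i) → ℕ
  | Sum.inl i => G.dist i j + 1
  | Sum.inr p => if p = ⟨j, b⟩ then 0 else
      if (corona G H).Adj (Sum.inr p) (Sum.inr ⟨j, b⟩) then 1 else G.dist p.1 j + 2

theorem corona_dist_inr (hG : G.Connected) (j : V) (b : W j) (x : V ⊕ (Σ i, W i)) :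
    (corona G H).dist x (Sum.inr ⟨j, b⟩) = coronaDist G H j b x := by
  have hd : ∀ i j, G.Adj i j → ∀ k, G.dist i k ≤ G.dist j k + 1 := by
    intro i j hij k
    have := hG.dist_triangle (u := i) (v := j) (w := k)
    rw [SimpleGraph.dist_eq_one_iff_adj.2 hij] at this
    omega
  have hle : ∀ p : Σ i, W i, coronaDist G H j b (Sum.inr p) ≤ G.dist p.1 j + 2 := by
    intro p
    simp only [coronaDist]
    split_ifs <;> omega
  have hge : ∀ p : Σ i, W i, G.dist p.1 j ≤ coronaDist G H j b (Sum.inr p) := by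
    intro p
    simp only [coronaDist]
    split_ifs with h1 h2
    · subst h1; simp
    · obtain ⟨i, a', b', rfl, h, -⟩ := h2
      obtain ⟨rfl, -⟩ := Sigma.mk.inj h
      simp
    · omega
  refine dist_eq_of_potential _ _ ?_ ?_ ?_ ?_ x
  · rintro (i | p) (i' | q) h
    · have := hd i i' h j
      simp only [coronaDist]; omega
    · obtain rfl : i = q.1 := h
      have := hge q
      change G.dist q.1 j + 1 ≤ _
      omega
    · obtain rfl : i' = p.1 := h
      have := hle p
      change _ ≤ G.dist p.1 j + 1 + 1
      omega
    · by_cases hq : q = ⟨j, b⟩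
      · subst hq
        simp only [coronaDist, if_pos h]
        split_ifs <;> omega
      · have h1 : 1 ≤ coronaDist G H j b (Sum.inr q) := by
          simp only [coronaDist, if_neg hq]
          split_ifs <;> omega
        have h2 := hle p
        -- In copy `j` all values are at most 2 and that of `q` is at least 1; on any other copy the
        -- potential is constant.
        by_cases hpj : p.1 = j
        · rw [hpj, SimpleGraph.dist_self] at h2
          omega
        · obtain ⟨i, a, a', rfl, rfl, h3⟩ := h
          have e : coronaDist G H j b (Sum.inr ⟨i, a'⟩) = G.dist i j + 2 := by
            simp only [coronaDist]
            rw [if_neg hq, if_neg]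
            rintro ⟨k, c, c', h4, h5, -⟩
            exact hpj ((Sigma.mk.inj h4).1.trans (Sigma.mk.inj h5).1.symm)
          rw [e]
          change _ ≤ G.dist i j + 2 at h2
          omega
  · simp [coronaDist]
  · rintro (i | p) h
    · simp [coronaDist] at h
    · simp only [coronaDist] at h
      split_ifs at h with h1
      rw [h1]
  · rintro (i | p) h
    · by_cases hij : i = j
      · subst hij
        exact ⟨Sum.inr ⟨i, b⟩, rfl, by simp [coronaDist]⟩
      · obtain ⟨z, hz, hz'⟩ := exists_adj_dist_add_one hG hij
        exact ⟨Sum.inl z, hz, by simp [coronaDist, hz']⟩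
    · by_cases hp : p = ⟨j, b⟩
      · simp [coronaDist, hp] at h
      · by_cases ha : (corona G H).Adj (Sum.inr p) (Sum.inr ⟨j, b⟩)
        · exact ⟨_, ha, by simp [coronaDist, hp, ha]⟩
        · exact ⟨Sum.inl p.1, rfl, by simp [coronaDist, hp, ha]⟩

theorem corona_dist_inl_inr (hG : G.Connected) (i j : V) (b : W j) :
    (corona G H).dist (Sum.inl i) (Sum.inr ⟨j, b⟩) = G.dist i j + 1 :=
  corona_dist_inr hG j b _

theorem corona_dist_inr_inl (hG : G.Connected) (i j : V) (b : W j) :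
    (corona G H).dist (Sum.inr ⟨j, b⟩) (Sum.inl i) = G.dist i j + 1 := by
  rw [SimpleGraph.dist_comm, corona_dist_inl_inr hG]

theorem corona_dist_inr_of_ne (hG : G.Connected) {i j : V} (hij : i ≠ j) (a : W i) (b : W j) :
    (corona G H).dist (Sum.inr ⟨i, a⟩) (Sum.inr ⟨j, b⟩) = G.dist i j + 2 := by
  rw [corona_dist_inr hG]
  simp only [coronaDist]
  rw [if_neg, if_neg]
  · rintro ⟨k, c, c', h4, h5, -⟩
    exact hij ((Sigma.mk.inj h4).1.trans (Sigma.mk.inj h5).1.symm)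
  · exact fun h => hij (Sigma.mk.inj h).1

open Classical in
theorem corona_dist_inr_same (hG : G.Connected) {i : V} (a b : W i) :
    (corona G H).dist (Sum.inr ⟨i, a⟩) (Sum.inr ⟨i, b⟩) =
      if a = b then 0 else if (H i).Adj a b then 1 else 2 := by
  rw [corona_dist_inr hG]
  simp only [coronaDist, corona_adj_inr_same, SimpleGraph.dist_self, zero_add]
  simp

end Corona

/-! ### Adjacency generators under complement and cone. -/

section AdjacencyGenerators

variable {V : Type u}

/-- The vertices that distinguish `x` and `y` by being one of them or by adjacency. -/
def adjDistinctive (H : SimpleGraph V) (x y : V) : Set V :=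
  {w | w = x ∨ w = y ∨ ¬ (H.Adj x w ↔ H.Adj y w)}

/-- `S` is a `k`-adjacency generator: any two different vertices are distinguished by at least `k`
elements of `S` through adjacency. -/
def IsKAdjGenerator (H : SimpleGraph V) (k : ℕ) (S : Set V) : Prop :=
  ∀ x y : V, x ≠ y → (k : ℕ∞) ≤ (S ∩ adjDistinctive H x y).encard

/-- `m` is the minimum cardinality of a `k`-adjacency generator. -/
def HasKAdjDim (H : SimpleGraph V) (k m : ℕ) : Prop :=
  (∀ S, IsKAdjGenerator H k S → (m : ℕ∞) ≤ S.encard) ∧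
    ∃ S, IsKAdjGenerator H k S ∧ S.encard = m

theorem adjDistinctive_compl (H : SimpleGraph V) (x y : V) :
    adjDistinctive Hᶜ x y = adjDistinctive H x y := by
  ext w
  simp only [adjDistinctive, Set.mem_ofPred_eq, SimpleGraph.compl_adj]
  by_cases h1 : w = x
  · simp [h1]
  by_cases h2 : w = y
  · simp [h2]
  have h1' : x ≠ w := Ne.symm h1
  have h2' : y ≠ w := Ne.symm h2
  simp only [h1, h2]
  tauto

theorem HasKAdjDim.compl {H : SimpleGraph V} {k m : ℕ} (h : HasKAdjDim H k m) :
    HasKAdjDim Hᶜ k m := by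
  simpa only [HasKAdjDim, IsKAdjGenerator, adjDistinctive_compl] using h

theorem join_adj_inr {U : Type w} (K : SimpleGraph U) (H : SimpleGraph V) (a b : V) :
    (join K H).Adj (Sum.inr a) (Sum.inr b) ↔ H.Adj a b := by
  simp [join]

theorem join_adj_inl_inr {U : Type w} (K : SimpleGraph U) (H : SimpleGraph V) (a : U) (b : V) :
    (join K H).Adj (Sum.inl a) (Sum.inr b) := by
  simp [join]

theorem encard_inr_image_inter {U : Type w} (S : Set V) (T : Set (U ⊕ V)) :
    (Sum.inr '' S ∩ T).encard = (S ∩ Sum.inr ⁻¹' T).encard := by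
  rw [← Set.image_inter_preimage, Sum.inr_injective.encard_image]

/-- The apex is adjacent to all of `H`, so it never separates two vertices of `H`; this gives the
lower bound. The apex and a vertex `x` are separated by all of `S` outside the at most two
neighbours of `x`, leaving at least `m - 2 ≥ k` elements. -/
theorem HasKAdjDim.cone {H : SimpleGraph V} {k m : ℕ} (h : HasKAdjDim H k m) (hm : k + 2 ≤ m)
    (hdeg : ∀ x, (H.neighborSet x).encard ≤ 2) :
    HasKAdjDim (join (⊤ : SimpleGraph Unit) H) k m := by
  constructor
  · intro S hS
    refine (h.1 (Sum.inr ⁻¹' S) fun x y hxy => ?_).trans ?_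
    · have := hS (Sum.inr x) (Sum.inr y) (by simpa using hxy)
      refine this.trans ?_
      rw [← (Sum.inr_injective (α := Unit) (β := V)).encard_image]
      refine Set.encard_le_encard ?_
      rintro (z | z) ⟨hz, hz'⟩
      · simp [adjDistinctive, SimpleGraph.adj_comm _ _ (Sum.inl z : Unit ⊕ V),
          join_adj_inl_inr] at hz'
      · refine ⟨z, ⟨hz, ?_⟩, rfl⟩
        simpa [adjDistinctive, join_adj_inr] using hz'
    · rw [← (Sum.inr_injective (α := Unit) (β := V)).encard_image]
      exact Set.encard_le_encard (Set.image_preimage_subset _ _)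
  · obtain ⟨S, hS, hSm⟩ := h.2
    refine ⟨Sum.inr '' S, ?_, by rw [Sum.inr_injective.encard_image, hSm]⟩
    have apex : ∀ x, (k : ℕ∞) ≤ (S \ H.neighborSet x).encard := by
      intro x
      have h1 : S.encard ≤ (S \ H.neighborSet x).encard + (H.neighborSet x).encard := by
        rw [← Set.encard_union_eq Set.disjoint_sdiff_left]
        exact Set.encard_le_encard (by simp)
      rw [hSm] at h1
      have h2 : (m : ℕ∞) ≤ (S \ H.neighborSet x).encard + 2 :=
        h1.trans (add_le_add le_rfl (hdeg x))
      have h3 : ((k : ℕ∞) + 2) ≤ (S \ H.neighborSet x).encard + 2 :=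
        le_trans (by exact_mod_cast hm) h2
      exact (ENat.add_le_add_iff_right (by simp)).1 h3
    rintro (x | x) (y | y) hxy
    · exact absurd rfl hxy
    · rw [encard_inr_image_inter]
      refine (apex y).trans (Set.encard_le_encard ?_)
      rintro z ⟨hz, hz'⟩
      refine ⟨hz, ?_⟩
      simp only [SimpleGraph.mem_neighborSet] at hz'
      simp [adjDistinctive, join_adj_inr, join_adj_inl_inr, hz']
    · rw [encard_inr_image_inter]
      refine (apex x).trans (Set.encard_le_encard ?_)
      rintro z ⟨hz, hz'⟩
      refine ⟨hz, ?_⟩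
      simp only [SimpleGraph.mem_neighborSet] at hz'
      simp [adjDistinctive, join_adj_inr, join_adj_inl_inr, hz']
    · rw [encard_inr_image_inter]
      refine (hS x y (by simpa using hxy)).trans (Set.encard_le_encard ?_)
      rintro z ⟨hz, hz'⟩
      refine ⟨hz, ?_⟩
      simpa [adjDistinctive, join_adj_inr] using hz'

end AdjacencyGenerators

/-! ### Reduction of `k`-metric dimension to adjacency dimension. -/

section CoronaDimension

variable {V : Type u} {W : V → Type v} {G : SimpleGraph V} {H : ∀ i, SimpleGraph (W i)}

/-- The embedding of `H i` into the corona product. -/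
def coronaCopy (i : V) (w : W i) : V ⊕ (Σ i, W i) := Sum.inr ⟨i, w⟩

theorem coronaCopy_injective (i : V) : Function.Injective (coronaCopy (W := W) i) :=
  fun _ _ h => eq_of_heq (Sigma.mk.inj (Sum.inr_injective h)).2

theorem sum_encard_preimage_coronaCopy_le [Fintype V] (S : Set (V ⊕ (Σ i, W i))) :
    ∑ i, (coronaCopy i ⁻¹' S).encard ≤ S.encard := by
  classical
  have key : ∀ A : Finset V, ∑ i ∈ A, (coronaCopy i ⁻¹' S).encard ≤
      (S ∩ {z | ∃ i ∈ A, ∃ w, z = coronaCopy i w}).encard := by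
    intro A
    induction A using Finset.induction_on with
    | empty => simp
    | insert i A hi ih =>
      rw [Finset.sum_insert hi, ← (coronaCopy_injective i).encard_image]
      refine (add_le_add le_rfl ih).trans ?_
      rw [← Set.encard_union_eq]
      · refine Set.encard_le_encard ?_
        rintro z (⟨w, hw, rfl⟩ | ⟨hz, j, hj, w, rfl⟩)
        · exact ⟨hw, i, by simp, w, rfl⟩
        · exact ⟨hz, j, by simp [hj], w, rfl⟩
      · rw [Set.disjoint_left]
        rintro _ ⟨w, hw, rfl⟩ ⟨-, j, hj, w', h⟩
        obtain ⟨rfl, -⟩ := Sigma.mk.inj (Sum.inr_injective h)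
        exact hi hj
  exact (key Finset.univ).trans (Set.encard_le_encard Set.inter_subset_left)

theorem encard_iUnion_coronaCopy_le [Fintype V] (T : ∀ i, Set (W i)) :
    (⋃ i, coronaCopy i '' T i).encard ≤ ∑ i, (T i).encard := by
  classical
  have key : ∀ A : Finset V, (⋃ i ∈ A, coronaCopy i '' T i).encard ≤
      ∑ i ∈ A, (T i).encard := by
    intro A
    induction A using Finset.induction_on with
    | empty => simp
    | insert i A hi ih =>
      rw [Finset.sum_insert hi, Finset.set_biUnion_insert]
      refine (Set.encard_union_le _ _).trans (add_le_add ?_ ih)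
      rw [(coronaCopy_injective i).encard_image]
  simpa using key Finset.univ

theorem mem_distinctive_coronaCopy (hG : G.Connected) {i : V} {x y w : W i} (hxy : x ≠ y) :
    coronaCopy i w ∈ distinctive (corona G H) (coronaCopy i x) (coronaCopy i y) ↔
      w ∈ adjDistinctive (H i) x y := by
  classical
  simp only [distinctive, coronaCopy, Set.mem_ofPred_eq, corona_dist_inr_same hG, adjDistinctive]
  by_cases h1 : x = w
  · subst h1
    have : y ≠ x := hxy.symm
    simp only [this, if_true, if_false, true_or, iff_true]
    split_ifs <;> omega
  by_cases h2 : y = w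
  · subst h2
    simp only [hxy, if_true, if_false, true_or, or_true, iff_true]
    split_ifs <;> omega
  have h1' : w ≠ x := Ne.symm h1
  have h2' : w ≠ y := Ne.symm h2
  simp only [h1, h2, h1', h2', if_false, false_or]
  split_ifs <;> simp_all

theorem distinctive_coronaCopy_subset (hG : G.Connected) {i : V} {x y : W i} :
    distinctive (corona G H) (coronaCopy i x) (coronaCopy i y) ⊆ Set.range (coronaCopy i) := by
  rintro (j | ⟨j, b⟩) h
  · simp [distinctive, coronaCopy, corona_dist_inr_inl hG] at h
  · by_cases hij : i = j
    · subst hij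
      exact ⟨b, rfl⟩
    · simp [distinctive, coronaCopy, corona_dist_inr_of_ne hG hij] at h

theorem IsKMetricGenerator.preimage_coronaCopy (hG : G.Connected) {k : ℕ}
    {S : Set (V ⊕ (Σ i, W i))} (hS : IsKMetricGenerator (corona G H) k S) (i : V) :
    IsKAdjGenerator (H i) k (coronaCopy i ⁻¹' S) := by
  intro x y hxy
  refine (hS _ _ ((coronaCopy_injective i).ne hxy)).trans ?_
  rw [← (coronaCopy_injective i).encard_image]
  refine Set.encard_le_encard ?_
  rintro z ⟨hz, hz'⟩
  obtain ⟨w, rfl⟩ := distinctive_coronaCopy_subset hG hz'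
  exact ⟨w, ⟨hz, (mem_distinctive_coronaCopy hG hxy).1 hz'⟩, rfl⟩

theorem isKMetricGenerator_iUnion_coronaCopy (hG : G.Connected) [Nontrivial V] {k : ℕ}
    {T : ∀ i, Set (W i)} (hT : ∀ i, IsKAdjGenerator (H i) k (T i))
    (hk : ∀ i, (k : ℕ∞) ≤ (T i).encard) :
    IsKMetricGenerator (corona G H) k (⋃ i, coronaCopy i '' T i) := by
  have copy : ∀ (x y : V ⊕ (Σ i, W i)) (i : V) (A : Set (W i)), A ⊆ T i → (k : ℕ∞) ≤ A.encard →
      (∀ w ∈ A, coronaCopy i w ∈ distinctive (corona G H) x y) →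
      (k : ℕ∞) ≤ ((⋃ i, coronaCopy i '' T i) ∩ distinctive (corona G H) x y).encard := by
    intro x y i A hA hAk h
    refine hAk.trans ?_
    rw [← (coronaCopy_injective i).encard_image]
    refine Set.encard_le_encard ?_
    rintro _ ⟨w, hw, rfl⟩
    exact ⟨Set.mem_iUnion.2 ⟨i, w, hA hw, rfl⟩, h w hw⟩
  have whole : ∀ (x y : V ⊕ (Σ i, W i)) (i : V),
      (∀ w, (corona G H).dist x (Sum.inr ⟨i, w⟩) ≠ (corona G H).dist y (Sum.inr ⟨i, w⟩)) →
      (k : ℕ∞) ≤ ((⋃ i, coronaCopy i '' T i) ∩ distinctive (corona G H) x y).encard :=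
    fun x y i h => copy x y i (T i) subset_rfl (hk i) fun w _ => h w
  have mixed : ∀ (i : V) (q : Σ i, W i) (w : W i), i ≠ q.1 →
      (corona G H).dist (Sum.inl i) (Sum.inr ⟨i, w⟩) ≠
        (corona G H).dist (Sum.inr q) (Sum.inr ⟨i, w⟩) := by
    rintro i ⟨j, b⟩ w hij
    rw [corona_dist_inl_inr hG, corona_dist_inr_of_ne hG (Ne.symm hij), SimpleGraph.dist_self]
    omega
  have root : ∀ (q : Σ i, W i) (i : V) (w : W i), i ≠ q.1 →
      (corona G H).dist (Sum.inl q.1) (Sum.inr ⟨i, w⟩) ≠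
        (corona G H).dist (Sum.inr q) (Sum.inr ⟨i, w⟩) := by
    rintro ⟨j, b⟩ i w hij
    rw [corona_dist_inl_inr hG, corona_dist_inr_of_ne hG (Ne.symm hij)]
    dsimp only
    omega
  rintro (i | ⟨i, a⟩) (j | ⟨j, b⟩) hxy
  · have hij : i ≠ j := fun h => hxy (by rw [h])
    refine whole _ _ i fun w => ?_
    have := hG.pos_dist_of_ne hij.symm
    rw [corona_dist_inl_inr hG, corona_dist_inl_inr hG, SimpleGraph.dist_self]
    omega
  · by_cases hij : i = j
    · subst hij
      -- The copy at `i` need not separate `i` from its own pendant vertex `b`, but every other copy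
      -- is one step farther from `b`.
      obtain ⟨l, hl⟩ := exists_ne i
      exact whole _ _ l fun w => root ⟨i, b⟩ l w hl
    · exact whole _ _ i fun w => mixed i ⟨j, b⟩ w hij
  · by_cases hij : j = i
    · subst hij
      obtain ⟨l, hl⟩ := exists_ne j
      exact whole _ _ l fun w => (root ⟨j, a⟩ l w hl).symm
    · exact whole _ _ j fun w => (mixed j ⟨i, a⟩ w hij).symm
  · by_cases hij : i = j
    · subst hij
      have hab : a ≠ b := fun h => hxy (by rw [h])
      exact copy _ _ i _ Set.inter_subset_left (hT i a b hab)
        fun w hw => (mem_distinctive_coronaCopy hG hab).2 hw.2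
    · refine whole _ _ i fun w => ?_
      classical
      have := hG.pos_dist_of_ne (Ne.symm hij)
      rw [corona_dist_inr_same hG, corona_dist_inr_of_ne hG (Ne.symm hij)]
      split_ifs <;> omega

theorem kMetricDim_corona [Fintype V] [Nontrivial V] (hG : G.Connected) {k : ℕ} {m : V → ℕ}
    (hH : ∀ i, HasKAdjDim (H i) k (m i)) (hk : ∀ i, k ≤ m i) :
    kMetricDim (corona G H) k = ((∑ i, m i : ℕ) : ℕ∞) := by
  rw [Nat.cast_sum]
  apply le_antisymm
  · choose T hT hTm using fun i => (hH i).2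
    have hgen : IsKMetricGenerator (corona G H) k (⋃ i, coronaCopy i '' T i) :=
      isKMetricGenerator_iUnion_coronaCopy hG hT fun i => by
        rw [hTm i]; exact_mod_cast hk i
    refine (iInf₂_le _ hgen).trans ((encard_iUnion_coronaCopy_le T).trans ?_)
    simp only [hTm, le_refl]
  · refine le_iInf₂ fun S hS => ?_
    refine le_trans (Finset.sum_le_sum fun i _ => ?_) (sum_encard_preimage_coronaCopy_le S)
    exact (hH i).1 _ (IsKMetricGenerator.preimage_coronaCopy hG hS i)

end CoronaDimension

theorem metricDim_eq_kMetricDim_one {V : Type u} (G : SimpleGraph V) :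
    metricDim G = kMetricDim G 1 := by
  have h : ∀ S, IsMetricGenerator G S ↔ IsKMetricGenerator G 1 S := by
    intro S
    refine forall₃_congr fun x y _ => ?_
    rw [Nat.cast_one, Set.one_le_encard_iff_nonempty]
    rfl
  simp only [metricDim, kMetricDim, h]

/-! ### Lower bounds for separating 0-1 sequences. -/

/-- The conditions on the indicator function of a set of vertices of the path `1, …, n` saying that
any two vertices of the path are distinguished `k` times by the adjacencies to that set. -/
structure PathSeparating (n k : ℕ) (f : ℕ → ℕ) : Prop where
  le_one : ∀ i, f i ≤ 1
  zero : f 0 = 0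
  last : f (n + 1) = 0
  adjacent : ∀ a, a + 2 ≤ n → k ≤ f a + f (a + 1) + f (a + 2) + f (a + 3)
  skip : ∀ a, a + 3 ≤ n → k ≤ f a + f (a + 1) + f (a + 3) + f (a + 4)
  far : ∀ a b, a + 3 ≤ b → b + 1 ≤ n →
    k ≤ f a + f (a + 1) + f (a + 2) + (f b + f (b + 1) + f (b + 2))

open Finset

/-- Blocks of five are removed from the right, each worth 2; an initial remainder of length 3 or 4
is worth 1. -/
theorem prefix_sum_ge (f : ℕ → ℕ) (p : ℕ) (h3 : 3 ≤ p → 1 ≤ f 0 + f 1 + f 2)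
    (h5 : ∀ a, a + 5 ≤ p → 2 ≤ f a + f (a + 1) + f (a + 2) + f (a + 3) + f (a + 4)) :
    ∀ q, q ≤ p → q / 5 + (q + 2) / 5 ≤ ∑ i ∈ range q, f i := by
  intro q
  induction q using Nat.strong_induction_on with
  | _ q ih =>
    intro hq
    obtain hlt | ⟨r, rfl⟩ : q < 5 ∨ ∃ r, q = r + 5 := by
      rcases Nat.lt_or_ge q 5 with h | h
      · exact .inl h
      · exact .inr ⟨q - 5, by omega⟩
    · interval_cases q <;> simp [sum_range_succ] <;> have := h3 (by omega) <;> omega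
    · have h1 := ih r (by omega) (by omega)
      have h2 := h5 r hq
      simp only [sum_range_succ] at *
      omega

theorem suffix_sum_ge (f : ℕ → ℕ) (p m : ℕ) (hpm : p ≤ m)
    (h3 : p + 3 ≤ m → 1 ≤ f (m - 1) + f (m - 2) + f (m - 3))
    (h5 : ∀ a, p ≤ a → a + 5 ≤ m → 2 ≤ f a + f (a + 1) + f (a + 2) + f (a + 3) + f (a + 4)) :
    (m - p) / 5 + (m - p + 2) / 5 + ∑ i ∈ range p, f i ≤ ∑ i ∈ range m, f i := by
  have h := prefix_sum_ge (fun i => f (m - 1 - i)) (m - p)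
    (fun h => by
      have := h3 (by omega)
      simpa [Nat.sub_sub, add_assoc] using this)
    (fun a ha => by
      have := h5 (m - 5 - a) (by omega) (by omega)
      rw [show m - 5 - a + 1 = m - 1 - (a + 3) by omega,
        show m - 5 - a + 2 = m - 1 - (a + 2) by omega,
        show m - 5 - a + 3 = m - 1 - (a + 1) by omega,
        show m - 5 - a + 4 = m - 1 - a by omega,
        show m - 5 - a = m - 1 - (a + 4) by omega] at this
      omega) (m - p) le_rfl
  have hs : ∑ i ∈ range m, f i = ∑ i ∈ range p, f i + ∑ i ∈ range (m - p), f (m - 1 - i) := by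
    obtain ⟨d, rfl⟩ := Nat.exists_eq_add_of_le hpm
    rw [sum_range_add, Nat.add_sub_cancel_left, ← sum_range_reflect (fun i => f (p + i))]
    congr 1
    refine sum_congr rfl fun i hi => ?_
    rw [mem_range] at hi
    congr 1
    omega
  omega

namespace PathSeparating

variable {n k : ℕ} {f : ℕ → ℕ}

/-- Two zero windows of length three would contradict `adjacent`, `skip` or `far`, according to
whether their starts differ by 1, by 2 or by more. -/
theorem exists_unique_gap (h : PathSeparating n 1 f) :
    ∃ u, ∀ a, a + 2 ≤ n + 1 → a ≠ u → 1 ≤ f a + f (a + 1) + f (a + 2) := by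
  by_contra! hc
  -- The value `n + 5` is out of range, so it excludes no window.
  obtain ⟨a, ha, -, ha'⟩ := hc (n + 5)
  obtain ⟨b, hb, hab, hb'⟩ := hc a
  have key : ∀ a b, a < b → b + 2 ≤ n + 1 → f a + f (a + 1) + f (a + 2) < 1 →
      f b + f (b + 1) + f (b + 2) < 1 → False := by
    intro a b hab hb h1 h2
    obtain rfl | rfl | h3 : b = a + 1 ∨ b = a + 2 ∨ a + 3 ≤ b := by omega
    · have := h.adjacent a (by omega)
      simp only [add_assoc, Nat.reduceAdd] at *
      omega
    · have := h.skip a (by omega)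
      simp only [add_assoc, Nat.reduceAdd] at *
      omega
    · have := h.far a b h3 (by omega)
      omega
  rcases lt_or_gt_of_ne hab with h1 | h1
  · exact key b a h1 ha hb' ha'
  · exact key a b h1 hb ha' hb'

/-- If its three windows are nonzero, a block of five has weight at least 2: a single one would sit
in the middle, against `skip`. Cutting inside the possible gap leaves two pieces to which this block
count applies. -/
theorem one_le_sum (h : PathSeparating n 1 f) :
    (2 * n + 2) / 5 ≤ ∑ i ∈ range (n + 2), f i := by
  obtain ⟨u, hu⟩ := h.exists_unique_gap
  have h5 : ∀ a, a + 5 ≤ n + 2 → (a + 2 < u ∨ u < a) ∨ u + 1 = a + 5 ∨ u + 1 = a + 4 ∨ u = a →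
      (u ≠ a ∧ u ≠ a + 1 ∧ u ≠ a + 2) →
      2 ≤ f a + f (a + 1) + f (a + 2) + f (a + 3) + f (a + 4) := by
    intro a ha _ hua
    have h1 := hu a (by omega) (by omega)
    have h2 := hu (a + 1) (by omega) (by omega)
    have h3 := hu (a + 2) (by omega) (by omega)
    have h4 := h.skip a (by omega)
    simp only [add_assoc, Nat.reduceAdd] at *
    omega
  have cut : ∀ p, p ≤ n + 2 → (p = u + 1 ∨ p = u + 2 ∨ n < u + 1) →
      (n + 2 - p) / 5 + (n + 2 - p + 2) / 5 + (p / 5 + (p + 2) / 5) ≤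
        ∑ i ∈ range (n + 2), f i := by
    intro p hp hpu
    have h1 := prefix_sum_ge f p (fun h3 => hu 0 (by omega) (by omega))
      (fun a ha => h5 a (by omega) (by omega) (by omega)) p le_rfl
    have h2 := suffix_sum_ge f p (n + 2) hp
      (fun h3 => by
        have := hu (n - 1) (by omega) (by omega)
        rw [show n - 1 + 1 = n by omega, show n - 1 + 2 = n + 1 by omega] at this
        simp only [show n + 2 - 1 = n + 1 by omega, show n + 2 - 2 = n by omega,
          show n + 2 - 3 = n - 1 by omega]
        omega)
      (fun a ha ha' => h5 a (by omega) (by omega) (by omega))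
    omega
  rcases Nat.lt_or_ge n (u + 1) with hn | hn
  · have := cut 0 (by omega) (by omega)
    omega
  · have h1 := cut (u + 1) (by omega) (by omega)
    have h2 := cut (u + 2) (by omega) (by omega)
    generalize ∑ i ∈ range (n + 2), f i = s at *
    obtain ⟨d, rfl⟩ := Nat.exists_eq_add_of_le hn
    rw [show u + 1 + d + 2 - (u + 1) = d + 2 by omega] at h1
    rw [show u + 1 + d + 2 - (u + 2) = d + 1 by omega] at h2
    have hr : u % 5 = 0 ∨ u % 5 = 1 ∨ u % 5 = 2 ∨ u % 5 = 3 ∨ u % 5 = 4 := by omega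
    have hd : d % 5 = 0 ∨ d % 5 = 1 ∨ d % 5 = 2 ∨ d % 5 = 3 ∨ d % 5 = 4 := by omega
    -- One cut falls short only if the two lengths are 2 and 2, or 2 and 4, modulo 5; the cut
    -- shifted by one then suffices.
    rcases hr with hr | hr | hr | hr | hr <;> rcases hd with hd | hd | hd | hd | hd <;> omega

/-- Blocks of four weigh at least 2. Starting the blocks after four or after six initial positions
(weight at least 2 or 3) covers all residues of `n`. -/
theorem two_le_sum (h : PathSeparating n 2 f) (hn : 6 ≤ n) :
    (n + 1 + 1) / 2 ≤ ∑ i ∈ range (n + 2), f i := by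
  have hb := h.le_one
  have p4 : 2 ≤ ∑ i ∈ range 4, f i := by
    have := h.adjacent 0 (by omega)
    simp only [sum_range_succ, range_zero, sum_empty]
    simpa using this
  have p6 : 3 ≤ ∑ i ∈ range 6, f i := by
    have h1 := h.adjacent 0 (by omega)
    have h2 := h.skip 0 (by omega)
    have h3 := h.skip 1 (by omega)
    have := hb 0; have := hb 1; have := hb 2; have := hb 3; have := hb 4; have := hb 5
    have := h.zero
    simp only [sum_range_succ, range_zero, sum_empty, zero_add, Nat.reduceAdd] at *
    omega
  have step : ∀ m, m + 3 ≤ n + 1 →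
      2 + ∑ i ∈ range m, f i ≤ ∑ i ∈ range (m + 4), f i := by
    intro m hm
    have h1 := h.adjacent m (by omega)
    simp only [sum_range_succ]
    omega
  have chain : ∀ c q, c + 4 * q ≤ n + 2 →
      2 * q + ∑ i ∈ range c, f i ≤ ∑ i ∈ range (c + 4 * q), f i := by
    intro c q
    induction q with
    | zero => simp
    | succ q ih =>
      intro hq
      have h1 := ih (by omega)
      have h2 := step (c + 4 * q) (by omega)
      rw [show c + 4 * (q + 1) = c + 4 * q + 4 by ring]
      omega
  have mono : ∀ a b, a ≤ b → ∑ i ∈ range a, f i ≤ ∑ i ∈ range b, f i := fun a b hab =>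
    sum_le_sum_of_subset (range_mono hab)
  have h6 := chain 6 ((n - 4) / 4) (by omega)
  have h4 := chain 4 ((n - 2) / 4) (by omega)
  have m6 := mono (6 + 4 * ((n - 4) / 4)) (n + 2) (by omega)
  have m4 := mono (4 + 4 * ((n - 2) / 4)) (n + 2) (by omega)
  omega

/-- Any five consecutive positions contain at most one zero, and the four positions at each end of
the path are forced to be 1. -/
theorem three_le_sum (h : PathSeparating n 3 f) (hn : 6 ≤ n) :
    n - (n - 4) / 5 ≤ ∑ i ∈ range (n + 2), f i := by
  have hb := h.le_one
  obtain ⟨m, rfl⟩ : ∃ m, n = m + 6 := ⟨n - 6, by omega⟩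
  have h5 : ∀ a, a + 4 ≤ m + 7 → 4 ≤ f a + f (a + 1) + f (a + 2) + f (a + 3) + f (a + 4) := by
    intro a ha
    have h1 := h.adjacent a (by omega)
    have h2 := h.adjacent (a + 1) (by omega)
    have h3 := h.skip a (by omega)
    have := hb a; have := hb (a + 1); have := hb (a + 2); have := hb (a + 3); have := hb (a + 4)
    simp only [add_assoc, Nat.reduceAdd] at *
    omega
  have start : f 1 = 1 ∧ f 2 = 1 ∧ f 3 = 1 ∧ f 4 = 1 := by
    have h1 := h.adjacent 0 (by omega)
    have h2 := h.skip 0 (by omega)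
    have := hb 1; have := hb 2; have := hb 3; have := hb 4
    have := h.zero
    simp only [zero_add] at *
    omega
  have finish : f (m + 3) = 1 ∧ f (m + 4) = 1 ∧ f (m + 5) = 1 ∧ f (m + 6) = 1 := by
    have h1 := h.adjacent (m + 4) (by omega)
    have h2 := h.skip (m + 3) (by omega)
    have := hb (m + 3); have := hb (m + 4); have := hb (m + 5); have := hb (m + 6)
    have := h.last
    simp only [add_assoc, Nat.reduceAdd] at *
    omega
  have key : ∀ q, q + 1 ≤ m + 8 → q - q / 5 ≤ ∑ i ∈ range (q + 1), f i := by
    intro q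
    induction q using Nat.strong_induction_on with
    | _ q ih =>
      intro hq
      obtain hlt | ⟨r, rfl⟩ : q < 5 ∨ ∃ r, q = r + 5 := by
        rcases Nat.lt_or_ge q 5 with h | h
        · exact .inl h
        · exact .inr ⟨q - 5, by omega⟩
      · interval_cases q <;> simp only [sum_range_succ, range_zero, sum_empty, zero_add] <;> omega
      · have h1 := ih r (by omega) (by omega)
        have h2 := h5 (r + 1) (by omega)
        rw [show r + 5 + 1 = (r + 1) + 5 by ring]
        simp only [sum_range_succ, add_assoc, Nat.reduceAdd] at *
        omega
  have h1 := key (m + 2) (by omega)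
  rw [show m + 6 + 2 = (m + 2 + 1) + 5 by ring]
  rw [sum_range_succ, sum_range_succ, sum_range_succ, sum_range_succ, sum_range_succ]
  simp only [add_assoc, Nat.reduceAdd] at *
  omega

end PathSeparating

/-! ### Optimal separating sequences. -/

theorem exists_pathSeparating_one {n : ℕ} (hn : 7 ≤ n) :
    ∃ f, PathSeparating n 1 f ∧ ∑ i ∈ range (n + 2), f i = (2 * n + 2) / 5 := by
  -- Residues 0 and 3 meet every three consecutive integers, so `0, 1, 2` can be the only gap. The
  -- endpoint `n` is added to avoid a second gap at the end if `n % 5 = 2`, and to separate `n - 2`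
  -- from `n` if `n % 5 = 4`.
  let f : ℕ → ℕ := fun i => if 1 ≤ i ∧ i ≤ n ∧
    (i % 5 = 0 ∨ i % 5 = 3 ∨ (i = n ∧ (n % 5 = 2 ∨ n % 5 = 4))) then 1 else 0
  have h0 : ∀ i, f i = 0 → ¬ (1 ≤ i ∧ i ≤ n ∧
      (i % 5 = 0 ∨ i % 5 = 3 ∨ (i = n ∧ (n % 5 = 2 ∨ n % 5 = 4)))) := by
    intro i hi hc
    simp only [f, if_pos hc] at hi
    omega
  have hsum : ∀ m, ∑ i ∈ range (m + 1), (if 1 ≤ i ∧ (i % 5 = 0 ∨ i % 5 = 3) then 1 else 0) =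
      m / 5 + (m + 2) / 5 := by
    intro m
    induction m with
    | zero => simp
    | succ m ih =>
      rw [sum_range_succ, ih]
      split_ifs <;> omega
  refine ⟨f, ⟨fun i => ?_, by simp [f], by simp [f], fun a ha => ?_, fun a ha => ?_,
    fun a b hab hb => ?_⟩, ?_⟩
  · simp only [f]; split_ifs <;> omega
  · by_contra hc
    have := h0 a (by omega); have := h0 (a + 1) (by omega)
    have := h0 (a + 2) (by omega); have := h0 (a + 3) (by omega)
    omega
  · by_contra hc
    have := h0 a (by omega); have := h0 (a + 1) (by omega)
    have := h0 (a + 3) (by omega); have := h0 (a + 4) (by omega)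
    omega
  · by_contra hc
    have := h0 b (by omega); have := h0 (b + 1) (by omega)
    have := h0 (b + 2) (by omega)
    omega
  · obtain ⟨m, rfl⟩ : ∃ m, n = m + 1 := ⟨n - 1, by omega⟩
    rw [sum_range_succ, sum_range_succ, sum_congr rfl (g := fun i =>
      if 1 ≤ i ∧ (i % 5 = 0 ∨ i % 5 = 3) then 1 else 0) ?_, hsum]
    · have hr : m % 5 = 0 ∨ m % 5 = 1 ∨ m % 5 = 2 ∨ m % 5 = 3 ∨ m % 5 = 4 := by omega
      simp only [f, true_and]
      rcases hr with hr | hr | hr | hr | hr <;> split_ifs <;> omega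
    · intro i hi
      rw [mem_range] at hi
      simp only [f]; split_ifs <;> omega

theorem exists_pathSeparating_two {n : ℕ} (hn : 6 ≤ n) :
    ∃ f, PathSeparating n 2 f ∧ ∑ i ∈ range (n + 2), f i = (n + 1 + 1) / 2 := by
  -- For even `n` the odd positions alone would separate `n - 1` from `n` only once.
  let f : ℕ → ℕ := fun i => if i ≤ n ∧ (i % 2 = 1 ∨ i = n) then 1 else 0
  have hsum : ∀ m, ∑ i ∈ range m, (if i % 2 = 1 then 1 else 0) = m / 2 := by
    intro m
    induction m with
    | zero => simp
    | succ m ih =>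
      rw [sum_range_succ, ih]
      split_ifs <;> omega
  have ht : ∀ a, a + 1 ≤ n → 1 ≤ f a + f (a + 1) := by
    intro a ha
    simp only [f]
    split_ifs <;> omega
  have hl : f (n + 1) = 0 := by simp [f]
  have hn1 : f n = 1 := by simp [f]
  refine ⟨f, ⟨fun i => ?_, by simp [f]; omega, hl, fun a ha => ?_, fun a ha => ?_,
    fun a b hab hb => ?_⟩, ?_⟩
  · simp only [f]; split_ifs <;> omega
  · simp only [f]; split_ifs <;> omega
  · simp only [f]; split_ifs <;> omega
  · have := ht a (by omega)
    have := ht b (by omega)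
    omega
  · rw [sum_range_succ, sum_range_succ, sum_congr rfl (g := fun i =>
      if i % 2 = 1 then 1 else 0) ?_, hsum, hl, hn1]
    · omega
    · intro i hi
      rw [mem_range] at hi
      simp only [f]; split_ifs <;> omega

theorem exists_pathSeparating_three {n : ℕ} (hn : 6 ≤ n) :
    ∃ f, PathSeparating n 3 f ∧ ∑ i ∈ range (n + 2), f i = n - (n - 4) / 5 := by
  -- Multiples of 5 are omitted, except among the last four positions, where ones are forced.
  let f : ℕ → ℕ := fun i => if 1 ≤ i ∧ i ≤ n ∧ ¬ (i % 5 = 0 ∧ i + 4 ≤ n) then 1 else 0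
  have hsum : ∀ m, ∑ i ∈ range (m + 1), (if 1 ≤ i ∧ ¬ i % 5 = 0 then 1 else 0) = m - m / 5 := by
    intro m
    induction m with
    | zero => simp
    | succ m ih =>
      rw [sum_range_succ, ih]
      split_ifs <;> omega
  have ht : ∀ a, a + 1 ≤ n → 2 ≤ f a + f (a + 1) + f (a + 2) := by
    intro a ha
    simp only [f]
    split_ifs <;> omega
  refine ⟨f, ⟨fun i => ?_, by simp [f], by simp [f], fun a ha => ?_, fun a ha => ?_,
    fun a b hab hb => ?_⟩, ?_⟩
  · simp only [f]; split_ifs <;> omega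
  · simp only [f]; split_ifs <;> omega
  · simp only [f]; split_ifs <;> omega
  · have := ht a (by omega)
    have := ht b (by omega)
    omega
  · obtain ⟨m, rfl⟩ : ∃ m, n = m + 4 := ⟨n - 4, by omega⟩
    rw [show m + 4 + 2 = (m + 1) + 5 by ring]
    rw [sum_range_succ, sum_range_succ, sum_range_succ, sum_range_succ, sum_range_succ,
      sum_congr rfl (g := fun i => if 1 ≤ i ∧ ¬ i % 5 = 0 then 1 else 0) ?_, hsum]
    · have h1 : f (m + 1) = 1 := if_pos (by omega)
      have h2 : f (m + 1 + 1) = 1 := if_pos (by omega)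
      have h3 : f (m + 1 + 2) = 1 := if_pos (by omega)
      have h4 : f (m + 1 + 3) = 1 := if_pos (by omega)
      have h5 : f (m + 1 + 4) = 0 := if_neg (by omega)
      rw [h1, h2, h3, h4, h5]
      omega
    · intro i hi
      rw [mem_range] at hi
      simp only [f]; split_ifs <;> omega


/-! ### Translation between paths and 0-1 sequences. -/

section Path

variable {W : Type u} {H : SimpleGraph W} {n k : ℕ}

/-- A labelling of the vertices of `H` by `1, …, n` identifying `H` with a path. -/
structure PathLabelling (H : SimpleGraph W) (n : ℕ) where
  label : W → ℕ
  injective : Function.Injective label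
  exists_label_iff : ∀ i, (∃ w, label w = i) ↔ 1 ≤ i ∧ i ≤ n
  adj_iff : ∀ a b, H.Adj a b ↔ label a + 1 = label b ∨ label b + 1 = label a

/-- The labelling given by an isomorphism with the path graph. -/
def PathLabelling.ofIso (e : H ≃g SimpleGraph.pathGraph n) : PathLabelling H n where
  label w := (e w).val + 1
  injective a b h := e.injective (Fin.ext (by simpa using h))
  exists_label_iff i := by
    constructor
    · rintro ⟨w, rfl⟩
      have := (e w).isLt
      omega
    · rintro ⟨h1, h2⟩
      refine ⟨e.symm ⟨i - 1, by omega⟩, ?_⟩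
      simp only [RelIso.apply_symm_apply]
      omega
  adj_iff a b := by
    rw [← e.map_adj_iff, SimpleGraph.pathGraph_adj]
    omega

namespace PathLabelling

variable (φ : PathLabelling H n)
include φ

theorem encard_neighborSet_le (x : W) : (H.neighborSet x).encard ≤ 2 := by
  rw [← φ.injective.encard_image]
  refine (Set.encard_le_encard (t := {φ.label x - 1, φ.label x + 1}) ?_).trans
    (Set.encard_insert_le _ _ |>.trans ?_)
  · rintro _ ⟨w, hw, rfl⟩
    rw [SimpleGraph.mem_neighborSet, φ.adj_iff] at hw
    simp only [Set.mem_insert_iff, Set.mem_singleton_iff]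
    omega
  · rw [Set.encard_singleton]; norm_num

open Classical in
/-- The indicator function of the set of labels of a set of vertices. -/
noncomputable def labelIndicator (S : Set W) (i : ℕ) : ℕ :=
  if ∃ w ∈ S, φ.label w = i then 1 else 0

theorem encard_inter_eq_sum (S P : Set W) (A : Finset ℕ) (hA : ∀ w, w ∈ P ↔ φ.label w ∈ A) :
    (S ∩ P).encard = ((∑ i ∈ A, φ.labelIndicator S i : ℕ) : ℕ∞) := by
  classical
  rw [← φ.injective.encard_image]
  have : φ.label '' (S ∩ P) = ((A.filter fun i => ∃ w ∈ S, φ.label w = i : Finset ℕ) : Set ℕ) := by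
    ext i
    simp only [Set.mem_image, Set.mem_inter_iff, coe_filter, Set.mem_ofPred_eq]
    constructor
    · rintro ⟨w, ⟨hw, hw'⟩, rfl⟩
      exact ⟨(hA w).1 hw', w, hw, rfl⟩
    · rintro ⟨hi, w, hw, rfl⟩
      exact ⟨w, ⟨hw, (hA w).2 hi⟩, rfl⟩
  rw [this, Set.encard_coe_eq_coe_finsetCard, card_filter]
  rfl

theorem encard_eq_sum (S : Set W) :
    S.encard = ((∑ i ∈ range (n + 2), φ.labelIndicator S i : ℕ) : ℕ∞) := by
  rw [← φ.encard_inter_eq_sum S Set.univ, Set.inter_univ]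
  intro w
  have := (φ.exists_label_iff (φ.label w)).1 ⟨w, rfl⟩
  simp only [Set.mem_univ, mem_range, true_iff]
  omega

theorem mem_adjDistinctive_iff (x y w : W) : w ∈ adjDistinctive H x y ↔
    φ.label w = φ.label x ∨ φ.label w = φ.label y ∨
      ¬ ((φ.label x + 1 = φ.label w ∨ φ.label w + 1 = φ.label x) ↔
        (φ.label y + 1 = φ.label w ∨ φ.label w + 1 = φ.label y)) := by
  rw [← φ.adj_iff, ← φ.adj_iff, φ.injective.eq_iff, φ.injective.eq_iff]
  rfl

theorem encard_adjacent (S : Set W) {x y : W} {a : ℕ} (hx : φ.label x = a + 1)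
    (hy : φ.label y = a + 2) : (S ∩ adjDistinctive H x y).encard =
      ((φ.labelIndicator S a + φ.labelIndicator S (a + 1) + φ.labelIndicator S (a + 2) +
        φ.labelIndicator S (a + 3) : ℕ) : ℕ∞) := by
  rw [φ.encard_inter_eq_sum S _ {a, a + 1, a + 2, a + 3}]
  · simp [add_assoc]
  · intro w
    rw [φ.mem_adjDistinctive_iff, hx, hy]
    simp only [mem_insert, mem_singleton]
    omega

/-- The common neighbour `a + 2` sees both vertices and drops out. -/
theorem encard_skip (S : Set W) {x y : W} {a : ℕ} (hx : φ.label x = a + 1)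
    (hy : φ.label y = a + 3) : (S ∩ adjDistinctive H x y).encard =
      ((φ.labelIndicator S a + φ.labelIndicator S (a + 1) + φ.labelIndicator S (a + 3) +
        φ.labelIndicator S (a + 4) : ℕ) : ℕ∞) := by
  rw [φ.encard_inter_eq_sum S _ {a, a + 1, a + 3, a + 4}]
  · simp [add_assoc]
  · intro w
    rw [φ.mem_adjDistinctive_iff, hx, hy]
    simp only [mem_insert, mem_singleton]
    omega

theorem encard_far (S : Set W) {x y : W} {a b : ℕ} (hx : φ.label x = a + 1)
    (hy : φ.label y = b + 1) (hab : a + 3 ≤ b) : (S ∩ adjDistinctive H x y).encard =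
      ((φ.labelIndicator S a + φ.labelIndicator S (a + 1) + φ.labelIndicator S (a + 2) +
        (φ.labelIndicator S b + φ.labelIndicator S (b + 1) + φ.labelIndicator S (b + 2)) : ℕ) :
        ℕ∞) := by
  rw [φ.encard_inter_eq_sum S _ {a, a + 1, a + 2, b, b + 1, b + 2}]
  · rw [sum_insert, sum_insert, sum_insert, sum_insert, sum_insert, sum_singleton]
    · simp only [add_assoc]
    all_goals
      simp only [mem_insert, mem_singleton]
      omega
  · intro w
    rw [φ.mem_adjDistinctive_iff, hx, hy]
    simp only [mem_insert, mem_singleton]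
    omega

theorem isKAdjGenerator_iff (S : Set W) :
    IsKAdjGenerator H k S ↔ PathSeparating n k (φ.labelIndicator S) := by
  have hout : ∀ i, ¬ (1 ≤ i ∧ i ≤ n) → φ.labelIndicator S i = 0 := fun i hi =>
    if_neg fun ⟨w, _, hw⟩ => hi ((φ.exists_label_iff i).1 ⟨w, hw⟩)
  constructor
  · intro h
    have pair : ∀ i j, 1 ≤ i → i < j → j ≤ n → ∃ x y, φ.label x = i ∧ φ.label y = j ∧
        (k : ℕ∞) ≤ (S ∩ adjDistinctive H x y).encard := by
      intro i j hi hij hj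
      obtain ⟨x, hx⟩ := (φ.exists_label_iff i).2 ⟨hi, by omega⟩
      obtain ⟨y, hy⟩ := (φ.exists_label_iff j).2 ⟨by omega, hj⟩
      refine ⟨x, y, hx, hy, h x y ?_⟩
      rintro rfl
      omega
    refine ⟨fun i => ?_, hout _ (by omega), hout _ (by omega), fun a ha => ?_, fun a ha => ?_,
      fun a b hab hb => ?_⟩
    · unfold labelIndicator
      split_ifs <;> omega
    · obtain ⟨x, y, hx, hy, hk⟩ := pair (a + 1) (a + 2) (by omega) (by omega) (by omega)
      rw [φ.encard_adjacent S hx hy] at hk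
      exact_mod_cast hk
    · obtain ⟨x, y, hx, hy, hk⟩ := pair (a + 1) (a + 3) (by omega) (by omega) (by omega)
      rw [φ.encard_skip S hx hy] at hk
      exact_mod_cast hk
    · obtain ⟨x, y, hx, hy, hk⟩ := pair (a + 1) (b + 1) (by omega) (by omega) (by omega)
      rw [φ.encard_far S hx hy hab] at hk
      exact_mod_cast hk
  · intro h
    have key : ∀ x y, φ.label x < φ.label y →
        (k : ℕ∞) ≤ (S ∩ adjDistinctive H x y).encard := by
      intro x y hxy
      have hx1 := (φ.exists_label_iff _).1 ⟨x, rfl⟩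
      have hy1 := (φ.exists_label_iff _).1 ⟨y, rfl⟩
      obtain ⟨a, hx⟩ : ∃ a, φ.label x = a + 1 := ⟨_, (Nat.sub_add_cancel hx1.1).symm⟩
      obtain ⟨b, hy⟩ : ∃ b, φ.label y = b + 1 := ⟨_, (Nat.sub_add_cancel hy1.1).symm⟩
      obtain rfl | rfl | hab : b = a + 1 ∨ b = a + 2 ∨ a + 3 ≤ b := by omega
      · rw [φ.encard_adjacent S hx hy]
        exact_mod_cast h.adjacent a (by omega)
      · rw [φ.encard_skip S hx hy]
        exact_mod_cast h.skip a (by omega)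
      · rw [φ.encard_far S hx hy hab]
        exact_mod_cast h.far a b hab (by omega)
    intro x y hxy
    rcases lt_or_gt_of_ne (φ.injective.ne hxy) with hlt | hlt
    · exact key x y hlt
    · have : adjDistinctive H x y = adjDistinctive H y x := by
        ext w
        simp only [adjDistinctive, Set.mem_ofPred_eq]
        tauto
      rw [this]
      exact key y x hlt

theorem exists_labelIndicator_eq {f : ℕ → ℕ} (hf : PathSeparating n k f)
    (hsupp : ∀ i, n < i → f i = 0) : ∃ S, φ.labelIndicator S = f := by
  refine ⟨{w | f (φ.label w) = 1}, funext fun i => ?_⟩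
  have h1 := hf.le_one i
  unfold labelIndicator
  split_ifs with h
  · obtain ⟨w, hw, rfl⟩ := h
    exact hw.symm
  · by_contra hc
    have hi : i ≠ 0 := fun hi => hc (by rw [hi, hf.zero])
    have hn : i ≤ n := le_of_not_gt fun hn => hc (hsupp i hn).symm
    obtain ⟨w, rfl⟩ := (φ.exists_label_iff i).2 ⟨by omega, hn⟩
    exact h ⟨w, show f (φ.label w) = 1 by omega, rfl⟩

theorem hasKAdjDim {m : ℕ}
    (lower : ∀ f, PathSeparating n k f → m ≤ ∑ i ∈ range (n + 2), f i)
    (upper : ∃ f, PathSeparating n k f ∧ ∑ i ∈ range (n + 2), f i = m) : HasKAdjDim H k m := by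
  constructor
  · intro S hS
    rw [φ.encard_eq_sum]
    exact_mod_cast lower _ ((φ.isKAdjGenerator_iff S).1 hS)
  · obtain ⟨f, hf, hfm⟩ := upper
    have hg : ∀ i, i < n + 2 → (if i ≤ n then f i else 0) = f i := by
      intro i hi
      split_ifs with h
      · rfl
      · rw [show i = n + 1 by omega, hf.last]
    -- `PathSeparating` leaves values beyond `n + 1` free, while a label indicator vanishes there;
    -- hence the truncation.
    have hsep : PathSeparating n k fun i => if i ≤ n then f i else 0 := by
      refine ⟨fun i => ?_, ?_, ?_, fun a ha => ?_, fun a ha => ?_, fun a b hab hb => ?_⟩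
      · split_ifs
        · exact hf.le_one i
        · omega
      · simpa using hf.zero
      · simp
      · rw [hg _ (by omega), hg _ (by omega), hg _ (by omega), hg _ (by omega)]
        exact hf.adjacent a ha
      · rw [hg _ (by omega), hg _ (by omega), hg _ (by omega), hg _ (by omega)]
        exact hf.skip a ha
      · rw [hg _ (by omega), hg _ (by omega), hg _ (by omega), hg _ (by omega), hg _ (by omega),
          hg _ (by omega)]
        exact hf.far a b hab hb
    obtain ⟨S, hS⟩ := φ.exists_labelIndicator_eq hsep fun i hi => if_neg (by omega)
    refine ⟨S, (φ.isKAdjGenerator_iff S).2 (hS ▸ hsep), ?_⟩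
    rw [φ.encard_eq_sum, hS, ← hfm, sum_congr rfl fun i hi => hg i (mem_range.1 hi)]

end PathLabelling

end Path

/-! ### Assembly. -/

theorem kMetricDim_corona_paths {V : Type u} [Fintype V] [Nontrivial V] {G : SimpleGraph V}
    (hG : G.Connected) {W : V → Type v} {H : ∀ i, SimpleGraph (W i)} {n : V → ℕ}
    (φ : ∀ i, PathLabelling (H i) (n i)) {k : ℕ} {m : V → ℕ} (hk : ∀ i, k + 2 ≤ m i)
    (lower : ∀ i f, PathSeparating (n i) k f → m i ≤ ∑ j ∈ Finset.range (n i + 2), f j)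
    (upper : ∀ i, ∃ f, PathSeparating (n i) k f ∧ ∑ j ∈ Finset.range (n i + 2), f j = m i) :
    kMetricDim (corona G H) k = ((∑ i, m i : ℕ) : ℕ∞) ∧
      kMetricDim (corona G (complFamily H)) k = ((∑ i, m i : ℕ) : ℕ∞) ∧
      kMetricDim (corona G (coneFamily H)) k = ((∑ i, m i : ℕ) : ℕ∞) := by
  have hdim : ∀ i, HasKAdjDim (H i) k (m i) := fun i => (φ i).hasKAdjDim (lower i) (upper i)
  have hk' : ∀ i, k ≤ m i := fun i => (Nat.le_add_right k 2).trans (hk i)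
  exact ⟨kMetricDim_corona hG hdim hk', kMetricDim_corona hG (fun i => (hdim i).compl) hk',
    kMetricDim_corona hG (fun i => (hdim i).cone (hk i) (φ i).encard_neighborSet_le) hk'⟩

end KMetric

theorem proposition3p19 {V : Type*} [Fintype V] (G : SimpleGraph V) (hG : G.Connected)
    (hV : 2 ≤ Fintype.card V) {W : V → Type*} (H : ∀ i, SimpleGraph (W i)) (n : V → ℕ)
    (hH : ∀ i, Nonempty (H i ≃g SimpleGraph.pathGraph (n i))) :
    ((∀ i, 7 ≤ n i) →
      KMetric.metricDim (KMetric.corona G H) = ((∑ i, (2 * n i + 2) / 5 : ℕ) : ℕ∞) ∧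
      KMetric.metricDim (KMetric.corona G (KMetric.complFamily H)) =
        ((∑ i, (2 * n i + 2) / 5 : ℕ) : ℕ∞) ∧
      KMetric.metricDim (KMetric.corona G (KMetric.coneFamily H)) =
        ((∑ i, (2 * n i + 2) / 5 : ℕ) : ℕ∞)) ∧
    ((∀ i, 6 ≤ n i) →
      KMetric.kMetricDim (KMetric.corona G H) 2 = ((∑ i, (n i + 1) ⌈/⌉ 2 : ℕ) : ℕ∞) ∧
      KMetric.kMetricDim (KMetric.corona G (KMetric.complFamily H)) 2 =
        ((∑ i, (n i + 1) ⌈/⌉ 2 : ℕ) : ℕ∞) ∧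
      KMetric.kMetricDim (KMetric.corona G (KMetric.coneFamily H)) 2 =
        ((∑ i, (n i + 1) ⌈/⌉ 2 : ℕ) : ℕ∞)) ∧
    ((∀ i, 6 ≤ n i) →
      KMetric.kMetricDim (KMetric.corona G H) 3 = ((∑ i, (n i - (n i - 4) / 5) : ℕ) : ℕ∞) ∧
      KMetric.kMetricDim (KMetric.corona G (KMetric.complFamily H)) 3 =
        ((∑ i, (n i - (n i - 4) / 5) : ℕ) : ℕ∞) ∧
      KMetric.kMetricDim (KMetric.corona G (KMetric.coneFamily H)) 3 =
        ((∑ i, (n i - (n i - 4) / 5) : ℕ) : ℕ∞)) := by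
  have : Nontrivial V := Fintype.one_lt_card_iff_nontrivial.1 hV
  have φ : ∀ i, KMetric.PathLabelling (H i) (n i) := fun i => .ofIso (hH i).some
  simp only [KMetric.metricDim_eq_kMetricDim_one, Nat.ceilDiv_eq_add_pred_div]
  refine ⟨fun hn => ?_, fun hn => ?_, fun hn => ?_⟩
  -- The cone needs `3 ≤ (2 * n i + 2) / 5`, which holds from `n i = 7` on and fails at 6.
  · refine KMetric.kMetricDim_corona_paths hG φ (fun i => ?_) (fun i f hf => hf.one_le_sum)
      fun i => KMetric.exists_pathSeparating_one (hn i)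
    have := hn i
    omega
  · refine KMetric.kMetricDim_corona_paths hG φ (fun i => ?_)
      (fun i f hf => hf.two_le_sum (hn i)) fun i => KMetric.exists_pathSeparating_two (hn i)
    have := hn i
    omega
  · refine KMetric.kMetricDim_corona_paths hG φ (fun i => ?_)
      (fun i f hf => hf.three_le_sum (hn i)) fun i => KMetric.exists_pathSeparating_three (hn i)
    have := hn i
    omega
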